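/- Let $\mathcal L_0,\mathcal L_1$ be disjoint first-order languages, each containing at least one constant symbol and having no function symbols of positive arity, and let $\mathcal M_k$ be an $\mathcal L_k$-structure with universe $M_k$ ($k=0,1$). The *standard simple product* $\mathcal N$ of $\mathcal M_0$ and $\mathcal M_1$ is the structure with universe $M_0\times M_1$ in the language consisting of: a constant symbol $C_{c_0,c_1}$ for each pair of constant symbols $c_0\in\mathcal L_0$, $c_1\in\mathcal L_1$, interpreted as $(c_0^{\mathcal M_0},c_1^{\mathcal M_1})$; each predicate symbol $R\in\mathcal L_k$ ($k=0,1$), interpreted by letting $R$ hold of a tuple of elements of $M_0\times M_1$ if and only if $R^{\mathcal M_k}$ holds of the tuple of their $k$-th coordinates; and binary predicates $\sim_0,\sim_1$, where $\sim_k$ is interpreted as equality of the $k$-th coordinates. For a complete theory $T$ and a set $I$ of cardinality $\lambda$, an *ict-pattern of depth $\lambda$* consists of formulas $\varphi_i(x;\bar y_i)$ ($i\in I$), where $x$ is a single variable and $\bar y_i$ is a finite tuple of variables, and tuples $\bar a_{i,j}$ ($i\in I$, $j<\omega$) from some model of $T$, such that for every $\eta: I\to\omega$ the set of formulas $$\{\varphi_i(x;\bar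 a_{i,\eta(i)}) : i\in I\}\cup\{\neg\varphi_i(x;\bar a_{i,j}) : i\in I,\ j\ne\eta(i)\}$$ is consistent (with the elementary diagram of that model). For a cardinal $\kappa$ and a structure $\mathcal M$, write $\textup{dp-rk}(\mathcal M)\le\kappa$ if $\textup{Th}(\mathcal M)$ has no ict-pattern of depth $\kappa^+$, where $\kappa^+$ is the successor cardinal of $\kappa$ (so $\kappa^+=\kappa+1$ for finite $\kappa$). **Proposition.** If $\kappa_0,\kappa_1$ are (finite or infinite) cardinals such that $\textup{dp-rk}(\mathcal M_k)\le\kappa_k$ for $k\in\{0,1\}$, then $$\textup{dp-rk}(\mathcal N)\le\kappa_0+\kappa_1 .$$ -/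

import Mathlib

universe u v w c u₀ v₀ w₀ u₁ v₁ w₁

namespace FirstOrder.Language

/-- An ict-pattern whose rows are indexed by `ι`, in one free variable `x`, for the theory `T`:
formulas `φ i (x; y)` with `y` a finite tuple of variables, and tuples `a i j` for `j < ω`, such
that for every `η : ι → ω` the set of formulas
`{φ i (x; a i (η i)) : i} ∪ {¬ φ i (x; a i j) : i, j ≠ η i}` is consistent.
All tuples live in one model `M` of `T`, which is taken large enough to realise each of these sets
of formulas, by an element `b η` (one may always pass to an elementary extension realising all of
the types in question, so no generality is lost). -/
structure IctPattern {L : Language.{u, v}} (T : L.Theory) (ι : Type c) where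
  /-- a model of `T` -/
  M : T.ModelType.{u, v, max u v c}
  /-- the length of the tuple of parameter variables in row `i` -/
  arity : ι → ℕ
  /-- the formula of row `i` -/
  φ : ∀ i : ι, L.Formula (Unit ⊕ Fin (arity i))
  /-- the array of parameters -/
  a : ∀ i : ι, ℕ → Fin (arity i) → M
  /-- the realisation of the path `η` -/
  b : (ι → ℕ) → M
  realize_iff : ∀ (η : ι → ℕ) (i : ι) (j : ℕ),
    (φ i).Realize (Sum.elim (fun _ => b η) (a i j)) ↔ j = η i

/-- The dp-rank of `T` is less than `κ`: there is no ict-pattern of depth `κ` in the partial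
type `x = x`, with `x` a single variable. -/
def DpRankLT {L : Language.{u, v}} (T : L.Theory) (κ : Cardinal.{c}) : Prop :=
  ∀ ι : Type c, Cardinal.mk ι = κ → IsEmpty (IctPattern T ι)

/-- The dp-rank of `T` is at most `κ`: it is less than the successor cardinal `κ⁺`
(which is `κ + 1` if `κ` is finite). -/
def DpRankLE {L : Language.{u, v}} (T : L.Theory) (κ : Cardinal.{c}) : Prop :=
  DpRankLT T (Order.succ κ)

/-- The dp-rank of a structure `M` is at most `κ`: the dp-rank of its complete theory is. -/
def StructureDpRankLE (L : Language.{u, v}) (M : Type w) [L.Structure M] (κ : Cardinal.{c}) :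
    Prop :=
  DpRankLE (L.completeTheory M) κ

/-- The function symbols of the language of the standard simple product: a constant symbol
`C_{c₀, c₁}` for every pair of constant symbols, and no other function symbols. -/
inductive SimpleProductFunctions (L₀ : Language.{u₀, v₀}) (L₁ : Language.{u₁, v₁}) :
    ℕ → Type (max u₀ u₁)
  | const (c₀ : L₀.Constants) (c₁ : L₁.Constants) : SimpleProductFunctions L₀ L₁ 0

/-- The relation symbols of the language of the standard simple product: the predicates of `L₀`,
those of `L₁` (taken to be disjoint from the former), and binary predicates `∼₀` and `∼₁`. -/
inductive SimpleProductRelations (L₀ : Language.{u₀, v₀}) (L₁ : Language.{u₁, v₁}) :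
    ℕ → Type (max v₀ v₁)
  | left {n : ℕ} (R : L₀.Relations n) : SimpleProductRelations L₀ L₁ n
  | right {n : ℕ} (R : L₁.Relations n) : SimpleProductRelations L₀ L₁ n
  | sim₀ : SimpleProductRelations L₀ L₁ 2
  | sim₁ : SimpleProductRelations L₀ L₁ 2

/-- The language of the standard simple product. It is meant for languages `L₀` and `L₁` whose
only function symbols are constants. -/
def simpleProduct (L₀ : Language.{u₀, v₀}) (L₁ : Language.{u₁, v₁}) :
    Language.{max u₀ u₁, max v₀ v₁} where
  Functions := SimpleProductFunctions L₀ L₁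
  Relations := SimpleProductRelations L₀ L₁

/-- The interpretation of the constants `C_{c₀, c₁}` in `M₀ × M₁`. -/
def simpleProductFunMap (L₀ : Language.{u₀, v₀}) (L₁ : Language.{u₁, v₁})
    (M₀ : Type w₀) (M₁ : Type w₁) [L₀.Structure M₀] [L₁.Structure M₁] :
    ∀ {n : ℕ}, SimpleProductFunctions L₀ L₁ n → (Fin n → M₀ × M₁) → M₀ × M₁
  | _, .const c₀ c₁, _ => ((c₀ : M₀), (c₁ : M₁))

/-- The interpretation of the predicates in `M₀ × M₁`: a predicate of `L₀` or `L₁` is read on the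
respective coordinates, and `∼ₖ` is equality of the `k`-th coordinates. -/
def simpleProductRelMap (L₀ : Language.{u₀, v₀}) (L₁ : Language.{u₁, v₁})
    (M₀ : Type w₀) (M₁ : Type w₁) [L₀.Structure M₀] [L₁.Structure M₁] :
    ∀ {n : ℕ}, SimpleProductRelations L₀ L₁ n → (Fin n → M₀ × M₁) → Prop
  | _, .left R, x => Structure.RelMap R fun i => (x i).1
  | _, .right R, x => Structure.RelMap R fun i => (x i).2
  | _, .sim₀, x => (x 0).1 = (x 1).1
  | _, .sim₁, x => (x 0).2 = (x 1).2

/-- The standard simple product of `M₀` and `M₁`, with universe `M₀ × M₁`. -/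
instance simpleProductStructure (L₀ : Language.{u₀, v₀}) (L₁ : Language.{u₁, v₁})
    (M₀ : Type w₀) (M₁ : Type w₁) [L₀.Structure M₀] [L₁.Structure M₁] :
    (simpleProduct L₀ L₁).Structure (M₀ × M₁) where
  funMap := simpleProductFunMap L₀ L₁ M₀ M₁
  RelMap := simpleProductRelMap L₀ L₁ M₀ M₁

end FirstOrder.Language

open Filter


/-! By a Feferman–Vaught argument (`exists_determining_formulas`), the truth of each row formula `φ
i` in the product depends only on finitely many formulas read in the two coordinates. Colour the
entry in row `i`, column `j`, seen from the path `η`, by the truth values of these formulas. In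
every row the colour of the column `η i` differs from all the others, but the others need not agree,
and the difference may be visible in coordinate 0 for one path and in coordinate 1 for another.

A Ramsey argument (`exists_pairs_of_finite_arrays`) replaces columns by pairs of columns: off the
path the two members of a pair have equal colours, and on the path they have two distinct colours
depending on the row alone. So each row is assigned to a coordinate that sees the difference, and
"some coordinate formula separates the pair" (`discernFormula`) is the row formula of a pattern in
that factor.

A model of the theory of the product need not itself be a product, so all this takes place on finite
pieces of the pattern inside `M₀ × M₁`. An ultrafilter makes the assignments coherent, and
compactness gives ict-patterns in both factors (`IctPattern.exists_split`). The rows thus split into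
sets of size at most `κ₀` and `κ₁`. -/

/-! ### Ramsey extraction of pairs of columns by ultrafilter limits. -/

theorem Ultrafilter.exists_eventually_eq {A Γ : Type*} [Finite Γ] (U : Ultrafilter A) (f : A → Γ) :
    ∃ g, ∀ᶠ a in U, f a = g := by
  have h : ∀ᶠ a in U, ∃ g ∈ (Set.univ : Set Γ), f a = g :=
    Eventually.of_forall fun a => ⟨f a, trivial, rfl⟩
  obtain ⟨g, -, hg⟩ := (Ultrafilter.eventually_exists_mem_iff Set.finite_univ).1 h
  exact ⟨g, hg⟩

/-- Ramsey's theorem for pairs in one row: finitely many disjoint pairs `(p s, q s)`, such that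
from the point of view of `q t` every pair other than the `t`-th has a single colour. -/
theorem exists_pairs_row {Γ : Type*} [Finite Γ] (U : Ultrafilter ℕ) (hU : (U : Filter ℕ) ≤ cofinite)
    (C : ℕ → ℕ → Γ) (D : Γ) (T : Set ℕ) (hT : T ∈ U) (hD : ∀ t ∈ T, ∀ᶠ j in U, C t j = D) (n : ℕ) :
    ∃ p q : Fin n → ℕ, (∀ s, q s ∈ T) ∧ (∀ s, p s ≠ q s) ∧
      ∀ t s, C (q t) (p s) = if s = t then D else C (q t) (q s) := by
  -- `E j` is the colour of column `j` as seen from almost all `t`. On a set where `E` has the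
  -- constant value `e`, late `t` see all earlier columns in colour `e`, while each `t ∈ T` sees
  -- late columns in colour `D`.
  choose E hE using fun j => U.exists_eventually_eq fun t => C t j
  obtain ⟨e, he⟩ := U.exists_eventually_eq E
  suffices H : ∀ S : Set ℕ, S ∈ U → S ⊆ T → (∀ j ∈ S, E j = e) →
      ∃ p q : Fin n → ℕ, (∀ s, p s ∈ S) ∧ (∀ s, q s ∈ S) ∧ (∀ s, p s ≠ q s) ∧
      ∀ t s, C (q t) (p s) = if s = t then D else C (q t) (q s) by
    obtain ⟨p, q, -, hq, h⟩ := H (T ∩ {j | E j = e}) (inter_mem hT he) Set.inter_subset_left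
      fun j hj => hj.2
    exact ⟨p, q, fun s => (hq s).1, h⟩
  clear hT
  induction n with
  | zero => exact fun _ _ _ _ => ⟨Fin.elim0, Fin.elim0, by simp, by simp, by simp, by simp⟩
  | succ n ih =>
    intro S hS hST hSe
    obtain ⟨q₀, hq₀⟩ := U.nonempty_of_mem hS
    have hDq : ∀ᶠ j in U, C q₀ j = D := hD _ (hST hq₀)
    have hne : ∀ᶠ j in U, j ≠ q₀ := hU (Set.finite_singleton q₀).compl_mem_cofinite
    obtain ⟨p₀, hp₀S, hp₀D, hp₀ne⟩ := (Eventually.and hS (hDq.and hne)).exists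
    have h₁ : ∀ᶠ t in U, C t p₀ = e := by rw [← hSe _ hp₀S]; exact hE _
    have h₂ : ∀ᶠ t in U, C t q₀ = e := by rw [← hSe _ hq₀]; exact hE _
    -- Later choices see both members of the first pair in colour `e`, and `q₀` sees both members of
    -- later pairs in colour `D`. Only `C (q t) (q t)` stays uncontrolled.
    obtain ⟨p, q, hp, hq, hpq, h⟩ := ih {t | t ∈ S ∧ C t p₀ = e ∧ C t q₀ = e ∧ C q₀ t = D}
      (Eventually.and hS (h₁.and (h₂.and hDq))) (fun t ht => hST ht.1) fun t ht => hSe _ ht.1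
    refine ⟨Fin.cons p₀ p, Fin.cons q₀ q, ?_, ?_, ?_, ?_⟩
    · exact Fin.cases hp₀S fun s => (hp s).1
    · exact Fin.cases hq₀ fun s => (hq s).1
    · exact Fin.cases hp₀ne hpq
    · intro t s
      refine Fin.cases ?_ (fun t => ?_) t <;> refine Fin.cases ?_ (fun s => ?_) s
      · simpa using hp₀D
      · simp [(hp s).2.2.2, (hq s).2.2.2]
      · simp [(hq t).2.1, (hq t).2.2.1, (Fin.succ_ne_zero t).symm]
      · simpa using h t s

/-- The version of `exists_pairs_row` for finitely many rows, with a colouring `v` of the paths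
that is made constant as well. -/
theorem exists_pairs_rows {Γ : Type u} [Finite Γ] (n : ℕ) (I : Type u) [Finite I] :
    ∀ (V : Type u) [Finite V] (c : (I → ℕ) → I → ℕ → Γ) (v : (I → ℕ) → V),
    ∃ p q : I → Fin n → ℕ, (∀ i s, p i s ≠ q i s) ∧ ∃ (d : I → Γ) (w : V), ∀ η : I → Fin n,
      v (fun i => q i (η i)) = w ∧ ∀ i s, c (fun i => q i (η i)) i (p i s) =
        if s = η i then d i else c (fun i => q i (η i)) i (q i s) := by
  induction I using Finite.induction_empty_option with
  | of_equiv e ih =>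
    intro V _ c v
    obtain ⟨p, q, hpq, d, w, h⟩ := ih V (fun η i j => c (η ∘ e.symm) (e i) j) (fun η => v (η ∘ e.symm))
    refine ⟨p ∘ e.symm, q ∘ e.symm, fun i s => hpq _ s, d ∘ e.symm, w, fun η => ?_⟩
    have h' := h (η ∘ e)
    simp only [Function.comp_def, Equiv.apply_symm_apply] at h' ⊢
    exact ⟨h'.1, fun i s => by simpa using h'.2 (e.symm i) s⟩
  | h_empty =>
    intro V _ c v
    exact ⟨PEmpty.elim, PEmpty.elim, fun i => i.elim, PEmpty.elim, v (fun i => i.elim),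
      fun η => ⟨congrArg v (funext fun i => i.elim), fun i => i.elim⟩⟩
  | @h_option I _ ih =>
    intro V _ c v
    let U := hyperfilter ℕ
    let ext : ℕ → (I → ℕ) → Option I → ℕ := fun x η o => o.elim x η
    -- The new row is first eliminated by taking limits in its path entry `x`; `D'` is the generic
    -- colour that `x` sees in the new row.
    choose c' hc' using fun η i j => U.exists_eventually_eq fun x => c (ext x η) (some i) j
    choose v' hv' using fun η => U.exists_eventually_eq fun x => v (ext x η)
    choose D' hD' using fun η x => U.exists_eventually_eq fun j => c (ext x η) none j
    choose D hD using fun η => U.exists_eventually_eq fun x => D' η x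
    -- Carrying `D η` along as a path colour makes the generic colour of the new row independent of
    -- the path in the old rows.
    obtain ⟨p, q, hpq, d, w, h⟩ := ih (V × Γ) c' fun η => (v' η, D η)
    let R := I → Fin n
    let path : R → I → ℕ := fun η i => q i (η i)
    have hT : ∀ᶠ x in U, ∀ η : R, v (ext x (path η)) = w.1 ∧ D' (path η) x = w.2 ∧
        ∀ i s, c (ext x (path η)) (some i) (p i s) = c' (path η) i (p i s) ∧
          c (ext x (path η)) (some i) (q i s) = c' (path η) i (q i s) := by
      refine eventually_all.2 fun η => ?_
      have hw := (h η).1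
      rw [Prod.ext_iff] at hw
      refine .and (by rw [← hw.1]; exact hv' _) (.and (by rw [← hw.2]; exact hD _) ?_)
      exact eventually_all.2 fun i => eventually_all.2 fun s => (hc' _ _ _).and (hc' _ _ _)
    -- The colour used here is the whole vector of colours over the finitely many old paths, so that
    -- one choice of pairs serves all of them.
    obtain ⟨p₀, q₀, hq₀, hpq₀, h₀⟩ := exists_pairs_row U hyperfilter_le_cofinite
      (fun x j (η : R) => c (ext x (path η)) none j) (fun _ => w.2) _ hT
      (fun x hx => by
        have : ∀ᶠ j in U, ∀ η : R, c (ext x (path η)) none j = w.2 :=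
          eventually_all.2 fun η => by rw [← (hx η).2.1]; exact hD' _ _
        exact this.mono fun j hj => funext hj) n
    refine ⟨fun o => o.elim p₀ p, fun o => o.elim q₀ q, ?_, fun o => o.elim w.2 d, w.1, ?_⟩
    · rintro (_ | i) s
      exacts [hpq₀ s, hpq i s]
    intro η
    have hη : (fun o : Option I => (o.elim q₀ q : Fin n → ℕ) (η o)) =
        ext (q₀ (η none)) (path fun i => η (some i)) := by
      funext o
      cases o <;> rfl
    rw [hη]
    have hx := hq₀ (η none) fun i => η (some i)
    refine ⟨hx.1, ?_⟩
    rintro (_ | i) s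
    · have := congrFun (h₀ (η none) s) fun i => η (some i)
      simp only [Option.elim_none]
      rw [this]
      split_ifs <;> rfl
    · simp only [Option.elim_some]
      rw [(hx.2.2 i s).1, (hx.2.2 i s).2]
      exact (h fun i => η (some i)).2 i s

/-- From arbitrarily large finite arrays of colours, in which `η i` is distinguished in row `i`
from the point of view of the path `η`, extract a finite array of pairs in which only the pair
number `η i` has two colours, which moreover depend on the row only. -/
theorem exists_pairs_of_finite_arrays {ι Γ : Type u} [Finite Γ] (I : Finset ι)
    (c : ℕ → (ι → ℕ) → ι → ℕ → Γ)
    (hc : ∀ N η i j, i ∈ I → (∀ i ∈ I, η i < N) → j < N → j ≠ η i → c N η i j ≠ c N η i (η i))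
    (n : ℕ) :
    ∃ (N : ℕ) (p q : ι → ℕ → ℕ) (d g : ι → Γ), ∀ η : ι → ℕ, (∀ i ∈ I, η i < n) →
      ∀ i ∈ I, d i ≠ g i ∧
      ∀ s < n, (c N (fun i => q i (η i)) i (p i s) = if s = η i then d i else
        c N (fun i => q i (η i)) i (q i s)) ∧
        (s = η i → c N (fun i => q i (η i)) i (q i s) = g i) := by
  classical
  let U := hyperfilter ℕ
  let ext : (I → ℕ) → ι → ℕ := fun η i => if h : i ∈ I then η ⟨i, h⟩ else 0
  have ext_apply : ∀ η (i : I), ext η i = η i := fun η i => by simp [ext]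
  -- The finite arrays have a limit array of infinite size; the pairs are found there and pulled
  -- back to one large `N`. The path colour records the colours of the on-path columns, whence `g`.
  choose c' hc' using fun (η : I → ℕ) (i : I) j => U.exists_eventually_eq fun N => c N (ext η) i j
  obtain ⟨p, q, hpq, d, w, h⟩ := exists_pairs_rows n I (I → Γ) c' fun η i => c' η i (η i)
  have hgt : ∀ k : ℕ, ∀ᶠ N : ℕ in U, k < N := fun k =>
    Nat.hyperfilter_le_atTop (eventually_gt_atTop k)
  have hN : ∀ᶠ N in U, (∀ i s, p i s < N) ∧ (∀ i s, q i s < N) ∧ ∀ (η : I → Fin n) (i : I) s,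
      c N (ext fun i => q i (η i)) i (p i s) = c' (fun i => q i (η i)) i (p i s) ∧
      c N (ext fun i => q i (η i)) i (q i s) = c' (fun i => q i (η i)) i (q i s) := by
    refine .and ?_ (.and ?_ ?_)
    · exact eventually_all.2 fun i => eventually_all.2 fun s => hgt _
    · exact eventually_all.2 fun i => eventually_all.2 fun s => hgt _
    · exact eventually_all.2 fun η => eventually_all.2 fun i => eventually_all.2 fun s =>
        (hc' (fun i => q i (η i)) i _).and (hc' (fun i => q i (η i)) i _)
  obtain ⟨N, hpN, hqN, hN⟩ := hN.exists
  let lift : (I → Fin n → ℕ) → ι → ℕ → ℕ := fun f i s =>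
    if h : i ∈ I ∧ s < n then f ⟨i, h.1⟩ ⟨s, h.2⟩ else 0
  by_cases hΓ : Nonempty Γ
  swap
  · refine ⟨N, lift p, lift q, fun i => (hΓ ⟨c 0 0 i 0⟩).elim, fun i => (hΓ ⟨c 0 0 i 0⟩).elim,
      fun η _ i => (hΓ ⟨c 0 0 i 0⟩).elim⟩
  obtain ⟨γ⟩ := hΓ
  refine ⟨N, lift p, lift q, fun i => if h : i ∈ I then d ⟨i, h⟩ else γ,
    fun i => if h : i ∈ I then w ⟨i, h⟩ else γ, fun η hη => ?_⟩
  let η' : I → Fin n := fun i => ⟨η i, hη i i.2⟩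
  have hpath : (fun i => lift q i (η i)) = ext fun i => q i (η' i) := by
    funext i
    by_cases hi : i ∈ I
    · simp [lift, ext, hi, hη i hi, η']
    · simp [lift, ext, hi]
  have hlt : ∀ i ∈ I, lift q i (η i) < N := fun i hi => by
    simpa [lift, hi, hη i hi] using hqN ⟨i, hi⟩ ⟨η i, hη i hi⟩
  have key : ∀ i (hi : i ∈ I), ∀ s (hs : s < n),
      (c N (fun i => lift q i (η i)) i (lift p i s) = if s = η i then d ⟨i, hi⟩ else
        c N (fun i => lift q i (η i)) i (lift q i s)) ∧
        (s = η i → c N (fun i => lift q i (η i)) i (lift q i s) = w ⟨i, hi⟩) := by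
    intro i hi s hs
    have e : ∀ f, lift f i s = f ⟨i, hi⟩ ⟨s, hs⟩ := fun f => by simp [lift, hi, hs]
    rw [hpath, e, e]
    have h₁ := hN η' ⟨i, hi⟩ ⟨s, hs⟩
    have h₂ := (h η').2 ⟨i, hi⟩ ⟨s, hs⟩
    rw [h₁.1, h₁.2]
    refine ⟨?_, ?_⟩
    · rw [h₂]
      simp [η']
    · rintro rfl
      exact congrFun (h η').1 ⟨i, hi⟩
  intro i hi
  simp only [hi, dif_pos]
  refine ⟨?_, key i hi⟩
  -- The limit is not needed for `d i ≠ g i`: these are the colours of two distinct columns below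
  -- `N`, one of them on the path, so `hc` applies.
  have h₁ := key i hi (η i) (hη i hi)
  rw [if_pos rfl] at h₁
  rw [← h₁.1, ← h₁.2 rfl]
  refine hc N _ i _ hi hlt ?_ ?_
  · simpa [lift, hi, hη i hi] using hpN ⟨i, hi⟩ ⟨η i, hη i hi⟩
  · simpa [lift, hi, hη i hi] using hpq ⟨i, hi⟩ ⟨η i, hη i hi⟩

namespace FirstOrder.Language

/-! ### Reduction of formulas in the product to the coordinates. -/

section FefermanVaught

variable {L₀ : Language.{u₀, v₀}} {L₁ : Language.{u₁, v₁}}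

theorem exists_term_fst (M₀ : Type w₀) (M₁ : Type w₁) [L₀.Structure M₀] [L₁.Structure M₁]
    {α : Type*} (t : (simpleProduct L₀ L₁).Term α) :
    ∃ s : L₀.Term α, ∀ v : α → M₀ × M₁, s.realize (Prod.fst ∘ v) = (t.realize v).1 := by
  cases t with
  | var a => exact ⟨.var a, fun _ => rfl⟩
  | func f ts =>
    cases f with
    | const c₀ c₁ => exact ⟨c₀.term, fun _ => Term.realize_constants⟩

theorem exists_term_snd (M₀ : Type w₀) (M₁ : Type w₁) [L₀.Structure M₀] [L₁.Structure M₁]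
    {α : Type*} (t : (simpleProduct L₀ L₁).Term α) :
    ∃ s : L₁.Term α, ∀ v : α → M₀ × M₁, s.realize (Prod.snd ∘ v) = (t.realize v).2 := by
  cases t with
  | var a => exact ⟨.var a, fun _ => rfl⟩
  | func f ts =>
    cases f with
    | const c₀ c₁ => exact ⟨c₁.term, fun _ => Term.realize_constants⟩

/-- If two tuples agree on the formulas `∃ y, ⋀ ± F l`, then every extension of the first by an
element is matched by an extension of the second with the same truth values of all `F l`. -/
theorem exists_snoc_realize_iff {L : Language.{u, v}} {M : Type w} [L.Structure M] {α : Type*}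
    {n : ℕ} {J : Type} [Finite J] (F : J → L.BoundedFormula α (n + 1)) {v v' : α → M}
    {xs xs' : Fin n → M}
    (h : ∀ σ : J → Bool, (BoundedFormula.iInf fun l => if σ l then F l else (F l).not).ex.Realize v xs ↔
      (BoundedFormula.iInf fun l => if σ l then F l else (F l).not).ex.Realize v' xs') (y : M) :
    ∃ y', ∀ l, (F l).Realize v (Fin.snoc xs y) ↔ (F l).Realize v' (Fin.snoc xs' y') := by
  classical
  have key : ∀ (σ : J → Bool) (v : α → M) (zs : Fin (n + 1) → M),
      (BoundedFormula.iInf fun l => if σ l then F l else (F l).not).Realize v zs ↔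
      ∀ l, (F l).Realize v zs ↔ σ l = true := by
    intro σ v zs
    rw [BoundedFormula.realize_iInf]
    refine forall_congr' fun l => ?_
    cases σ l <;> simp
  have hy : (BoundedFormula.iInf fun l => if decide ((F l).Realize v (Fin.snoc xs y)) then F l
      else (F l).not).ex.Realize v xs :=
    BoundedFormula.realize_ex.2 ⟨y, (key _ _ _).2 fun l => decide_eq_true_iff.symm⟩
  obtain ⟨y', hy'⟩ := BoundedFormula.realize_ex.1 ((h _).1 hy)
  exact ⟨y', fun l => decide_eq_true_iff.symm.trans ((key _ _ _).1 hy' l).symm⟩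

/-- The truth of a formula in the simple product is determined by the truth values of finitely
many formulas in the two coordinates. -/
theorem exists_determining_formulas (M₀ : Type w₀) (M₁ : Type w₁) [L₀.Structure M₀]
    [L₁.Structure M₁] {α : Type*} {n : ℕ} (φ : (simpleProduct L₀ L₁).BoundedFormula α n) :
    ∃ (J₀ J₁ : Type) (_ : Finite J₀) (_ : Finite J₁) (F₀ : J₀ → L₀.BoundedFormula α n)
      (F₁ : J₁ → L₁.BoundedFormula α n), ∀ (v v' : α → M₀ × M₁) (xs xs' : Fin n → M₀ × M₁),
      (∀ l, (F₀ l).Realize (Prod.fst ∘ v) (Prod.fst ∘ xs) ↔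
        (F₀ l).Realize (Prod.fst ∘ v') (Prod.fst ∘ xs')) →
      (∀ l, (F₁ l).Realize (Prod.snd ∘ v) (Prod.snd ∘ xs) ↔
        (F₁ l).Realize (Prod.snd ∘ v') (Prod.snd ∘ xs')) →
      (φ.Realize v xs ↔ φ.Realize v' xs') := by
  induction φ with
  | falsum => exact ⟨Empty, Empty, inferInstance, inferInstance, Empty.elim, Empty.elim,
      fun _ _ _ _ _ _ => Iff.rfl⟩
  | equal t s =>
    obtain ⟨t₀, ht₀⟩ := exists_term_fst M₀ M₁ t
    obtain ⟨s₀, hs₀⟩ := exists_term_fst M₀ M₁ s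
    obtain ⟨t₁, ht₁⟩ := exists_term_snd M₀ M₁ t
    obtain ⟨s₁, hs₁⟩ := exists_term_snd M₀ M₁ s
    refine ⟨Unit, Unit, inferInstance, inferInstance, fun _ => .equal t₀ s₀, fun _ => .equal t₁ s₁,
      fun v v' xs xs' h₀ h₁ => ?_⟩
    have h₀ := h₀ ()
    have h₁ := h₁ ()
    simp only [BoundedFormula.Realize, ← Sum.comp_elim, ht₀, hs₀, ht₁, hs₁] at h₀ h₁ ⊢
    rw [Prod.ext_iff, Prod.ext_iff, h₀, h₁]
  | rel R ts =>
    choose t₀ ht₀ using fun i => exists_term_fst M₀ M₁ (ts i)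
    choose t₁ ht₁ using fun i => exists_term_snd M₀ M₁ (ts i)
    cases R with
    | left R =>
      refine ⟨Unit, Empty, inferInstance, inferInstance, fun _ => .rel R t₀, Empty.elim,
        fun v v' xs xs' h₀ _ => ?_⟩
      have h₀ := h₀ ()
      simp only [BoundedFormula.Realize, ← Sum.comp_elim, ht₀] at h₀
      exact h₀
    | right R =>
      refine ⟨Empty, Unit, inferInstance, inferInstance, Empty.elim, fun _ => .rel R t₁,
        fun v v' xs xs' _ h₁ => ?_⟩
      have h₁ := h₁ ()
      simp only [BoundedFormula.Realize, ← Sum.comp_elim, ht₁] at h₁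
      exact h₁
    | sim₀ =>
      refine ⟨Unit, Empty, inferInstance, inferInstance, fun _ => .equal (t₀ 0) (t₀ 1), Empty.elim,
        fun v v' xs xs' h₀ _ => ?_⟩
      have h₀ := h₀ ()
      simp only [BoundedFormula.Realize, ← Sum.comp_elim, ht₀] at h₀
      exact h₀
    | sim₁ =>
      refine ⟨Empty, Unit, inferInstance, inferInstance, Empty.elim, fun _ => .equal (t₁ 0) (t₁ 1),
        fun v v' xs xs' _ h₁ => ?_⟩
      have h₁ := h₁ ()
      simp only [BoundedFormula.Realize, ← Sum.comp_elim, ht₁] at h₁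
      exact h₁
  | imp φ ψ ihφ ihψ =>
    obtain ⟨J₀, J₁, _, _, F₀, F₁, h⟩ := ihφ
    obtain ⟨J₀', J₁', _, _, F₀', F₁', h'⟩ := ihψ
    refine ⟨J₀ ⊕ J₀', J₁ ⊕ J₁', inferInstance, inferInstance, Sum.elim F₀ F₀', Sum.elim F₁ F₁',
      fun v v' xs xs' h₀ h₁ => ?_⟩
    rw [BoundedFormula.realize_imp, BoundedFormula.realize_imp,
      h v v' xs xs' (fun l => h₀ (.inl l)) (fun l => h₁ (.inl l)),
      h' v v' xs xs' (fun l => h₀ (.inr l)) (fun l => h₁ (.inr l))]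
  | @all n φ ih =>
    obtain ⟨J₀, J₁, _, _, F₀, F₁, h⟩ := ih
    -- Witnesses in the two coordinates can be matched separately, because any pair of elements is
    -- an element of the product.
    let G₀ (σ : J₀ → Bool) := (BoundedFormula.iInf fun l => if σ l then F₀ l else (F₀ l).not).ex
    let G₁ (σ : J₁ → Bool) := (BoundedFormula.iInf fun l => if σ l then F₁ l else (F₁ l).not).ex
    refine ⟨J₀ → Bool, J₁ → Bool, inferInstance, inferInstance, G₀, G₁, ?_⟩
    have key : ∀ (v v' : α → M₀ × M₁) (xs xs' : Fin n → M₀ × M₁),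
        (∀ σ, (G₀ σ).Realize (Prod.fst ∘ v) (Prod.fst ∘ xs) ↔
          (G₀ σ).Realize (Prod.fst ∘ v') (Prod.fst ∘ xs')) →
        (∀ σ, (G₁ σ).Realize (Prod.snd ∘ v) (Prod.snd ∘ xs) ↔
          (G₁ σ).Realize (Prod.snd ∘ v') (Prod.snd ∘ xs')) →
        φ.all.Realize v' xs' → φ.all.Realize v xs := by
      intro v v' xs xs' h₀ h₁ hφ y
      obtain ⟨y₀, hy₀⟩ := exists_snoc_realize_iff F₀ h₀ y.1
      obtain ⟨y₁, hy₁⟩ := exists_snoc_realize_iff F₁ h₁ y.2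
      refine (h v v' (Fin.snoc xs y) (Fin.snoc xs' (y₀, y₁)) ?_ ?_).2 (hφ (y₀, y₁))
      · simpa only [Fin.comp_snoc] using hy₀
      · simpa only [Fin.comp_snoc] using hy₁
    exact fun v v' xs xs' h₀ h₁ => ⟨key v' v xs' xs (fun σ => (h₀ σ).symm) fun σ => (h₁ σ).symm,
      key v v' xs xs' h₀ h₁⟩

end FefermanVaught
-- Transfer of finite configurations, and compactness.
section Transfer

variable {L : Language.{u, v}}

theorem realize_exClosure_iff_exists_realize {M : Type w} [L.Structure M] [Nonempty M] {α : Type*}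
    [DecidableEq α] (φ : L.Formula α) : M ⊨ φ.exClosure ↔ ∃ v : α → M, φ.Realize v := by
  rw [← Formula.exists_realize_equivSentence_iff_realize_exClosure]
  refine exists_congr fun v => ?_
  rw [← Formula.realize_equivSentence_symm M (Formula.equivSentence φ) v,
    _root_.Equiv.symm_apply_apply]

theorem exists_realize_of_model_completeTheory {M : Type w} [L.Structure M] [Nonempty M]
    {P : Type*} [L.Structure P] [Nonempty P] [P ⊨ L.completeTheory M] {α β : Type*} [Finite β]
    (f : β → L.Formula α) (v : α → P) (hv : ∀ x, (f x).Realize v) :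
    ∃ v : α → M, ∀ x, (f x).Realize v := by
  classical
  have h : P ⊨ (Formula.iInf f).exClosure :=
    (realize_exClosure_iff_exists_realize _).2 ⟨v, Formula.realize_iInf.2 hv⟩
  rw [realize_iff_of_model_completeTheory M P, realize_exClosure_iff_exists_realize] at h
  obtain ⟨v, hv⟩ := h
  exact ⟨v, Formula.realize_iInf.1 hv⟩

/-- Compactness, with the variables in `α` turned into new constants; `M` itself, with suitable
constants, models each finite part. -/
theorem exists_model_realize_of_finite {M : Type w} [L.Structure M] [Nonempty M] {α : Type c}
    {β : Type*} (f : β → L.Formula α)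
    (hf : ∀ s : Finset β, ∃ v : α → M, ∀ x ∈ s, (f x).Realize v) :
    ∃ (P : (L.completeTheory M).ModelType.{u, v, max u v c}) (v : α → P),
      ∀ x, (f x).Realize v := by
  classical
  let T : L[[α]].Theory := (L.lhomWithConstants α).onTheory (L.completeTheory M) ∪
    Set.range fun x => Formula.equivSentence (f x)
  have hT : T.IsSatisfiable := by
    rw [Theory.isSatisfiable_iff_isFinitelySatisfiable]
    intro T₀ hT₀
    have hsub : ∀ ψ ∈ T₀, ψ ∈ (L.lhomWithConstants α).onTheory (L.completeTheory M) ∨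
        ∃ x, Formula.equivSentence (f x) = ψ := fun ψ hψ => hT₀ hψ
    have : ∃ s : Finset β, ∀ ψ ∈ T₀, ψ ∈ (L.lhomWithConstants α).onTheory (L.completeTheory M) ∨
        ∃ x ∈ s, Formula.equivSentence (f x) = ψ := by
      clear hT₀
      induction T₀ using Finset.induction_on with
      | empty => exact ⟨∅, by simp⟩
      | insert ψ T₀ _ ih =>
        obtain ⟨s, hs⟩ := ih fun ψ hψ => hsub ψ (Finset.mem_insert_of_mem hψ)
        rcases hsub ψ (Finset.mem_insert_self _ _) with h | ⟨x, hx⟩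
        · refine ⟨s, fun χ hχ => ?_⟩
          rcases Finset.mem_insert.1 hχ with rfl | hχ
          exacts [.inl h, hs _ hχ]
        · refine ⟨insert x s, fun χ hχ => ?_⟩
          rcases Finset.mem_insert.1 hχ with rfl | hχ
          · exact .inr ⟨x, Finset.mem_insert_self _ _, hx⟩
          · exact (hs _ hχ).imp_right fun ⟨y, hy, e⟩ => ⟨y, Finset.mem_insert_of_mem hy, e⟩
    obtain ⟨s, hs⟩ := this
    obtain ⟨v, hv⟩ := hf s
    let := constantsOn.structure v
    have : M ⊨ (T₀ : L[[α]].Theory) := by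
      rw [Theory.model_iff]
      intro ψ hψ
      rcases hs ψ hψ with h | ⟨x, hx, rfl⟩
      · exact ((LHom.onTheory_model (L.lhomWithConstants α) (L.completeTheory M)).2
          inferInstance).realize_of_mem ψ h
      · exact (Formula.realize_equivSentence M (f x)).2 (hv x hx)
    exact Theory.Model.isSatisfiable M
  obtain ⟨N⟩ := hT
  have hN : N ⊨ (L.lhomWithConstants α).onTheory (L.completeTheory M) :=
    N.is_model.mono Set.subset_union_left
  let := (L.lhomWithConstants α).reduct N
  have hN' : N ⊨ L.completeTheory M := (LHom.onTheory_model (L.lhomWithConstants α) _).1 hN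
  refine ⟨⟨N⟩, fun a => (L.con a : N), fun x => ?_⟩
  have hx : N ⊨ Formula.equivSentence (f x) :=
    N.is_model.realize_of_mem _ (Set.mem_union_right _ ⟨x, rfl⟩)
  exact (Formula.realize_equivSentence N (f x)).1 hx

end Transfer

/-! ### Ict-patterns and their finite pieces. -/

section FinitePatterns

variable {L : Language.{u, v}} {ι : Type c} {k : ι → ℕ}

/-- Every finite piece of an ict-pattern with formulas `φ` can be found in the structure `M`. -/
def HasFinitePatterns (M : Type w) [L.Structure M] (φ : ∀ i, L.Formula (Unit ⊕ Fin (k i)))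
    (I : Finset ι) (n : ℕ) : Prop :=
  ∃ (a : ∀ i, ℕ → Fin (k i) → M) (b : (ι → ℕ) → M), ∀ η : ι → ℕ, (∀ i ∈ I, η i < n) →
    ∀ i ∈ I, ∀ j < n, (φ i).Realize (Sum.elim (fun _ => b η) (a i j)) ↔ j = η i

open Classical in
/-- The condition of an ict-pattern for the path `x.1` at row `x.2.1` and column `x.2.2`, with a
variable for every entry of the array and for the realisation of every path. -/
noncomputable def ictCondition (φ : ∀ i, L.Formula (Unit ⊕ Fin (k i))) (x : (ι → ℕ) × ι × ℕ) :
    L.Formula ((Σ i, ℕ × Fin (k i)) ⊕ (ι → ℕ)) :=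
  let ψ := (φ x.2.1).relabel
    (Sum.elim (fun _ => Sum.inr x.1) fun l => Sum.inl ⟨x.2.1, x.2.2, l⟩)
  if x.2.2 = x.1 x.2.1 then ψ else ψ.not

theorem realize_ictCondition {M : Type w} [L.Structure M]
    (φ : ∀ i, L.Formula (Unit ⊕ Fin (k i))) (x : (ι → ℕ) × ι × ℕ)
    (v : (Σ i, ℕ × Fin (k i)) ⊕ (ι → ℕ) → M) :
    (ictCondition φ x).Realize v ↔ ((φ x.2.1).Realize (Sum.elim (fun _ => v (.inr x.1))
      fun l => v (.inl ⟨x.2.1, x.2.2, l⟩)) ↔ x.2.2 = x.1 x.2.1) := by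
  have e : v ∘ (Sum.elim (fun _ : Unit => Sum.inr x.1) fun l => Sum.inl ⟨x.2.1, x.2.2, l⟩) =
      Sum.elim (fun _ => v (.inr x.1)) fun l => v (.inl ⟨x.2.1, x.2.2, l⟩) := by
    rw [Sum.comp_elim]
    rfl
  unfold ictCondition
  dsimp only
  split_ifs with h
  · rw [Formula.realize_relabel, e]
    exact (iff_true_right h).symm
  · rw [Formula.realize_not, Formula.realize_relabel, e]
    exact (iff_false_right h).symm

/-- Only the paths `I → Fin n` matter, so a finite piece is finitely many conditions and transfers
to `M` by elementary equivalence. -/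
theorem IctPattern.hasFinitePatterns {M : Type w} [L.Structure M] [Nonempty M]
    (p : IctPattern (L.completeTheory M) ι) (I : Finset ι) (n : ℕ) :
    HasFinitePatterns M p.φ I n := by
  classical
  let ext : (I → Fin n) → ι → ℕ := fun η i => if h : i ∈ I then η ⟨i, h⟩ else 0
  obtain ⟨v, hv⟩ := exists_realize_of_model_completeTheory (M := M) (P := p.M)
    (fun x : (I → Fin n) × I × Fin n => ictCondition p.φ (ext x.1, x.2.1, x.2.2))
    (Sum.elim (fun y => p.a y.1 y.2.1 y.2.2) p.b)
    (fun x => (realize_ictCondition _ _ _).2 (p.realize_iff _ _ _))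
  refine ⟨fun i j l => v (.inl ⟨i, j, l⟩),
    fun η => v (.inr fun i => if i ∈ I then η i else 0), fun η hη i hi j hj => ?_⟩
  have h := (realize_ictCondition _ _ _).1
    (hv (fun i => ⟨η i, hη i i.2⟩, ⟨i, hi⟩, ⟨j, hj⟩))
  have e : ext (fun i => ⟨η i, hη i i.2⟩) = fun i => if i ∈ I then η i else 0 := by
    funext i
    by_cases hi : i ∈ I <;> simp [ext, hi]
  simpa [e, hi] using h

theorem nonempty_ictPattern {M : Type w} [L.Structure M] [Nonempty M]
    (φ : ∀ i, L.Formula (Unit ⊕ Fin (k i))) (h : ∀ I n, HasFinitePatterns M φ I n) :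
    Nonempty (IctPattern (L.completeTheory M) ι) := by
  classical
  obtain ⟨P, v, hv⟩ := exists_model_realize_of_finite (M := M) (ictCondition φ) (by
    intro s
    obtain ⟨n, hn⟩ : ∃ n, ∀ x ∈ s, x.2.2 < n ∧ ∀ y ∈ s, x.1 y.2.1 < n := by
      have hev : ∀ᶠ n in (atTop : Filter ℕ), ∀ x ∈ s, x.2.2 < n ∧ ∀ y ∈ s, x.1 y.2.1 < n :=
        (Finset.eventually_all s).2 fun x _ => (eventually_gt_atTop _).and
          ((Finset.eventually_all s).2 fun y _ => eventually_gt_atTop _)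
      exact hev.exists
    obtain ⟨a, b, hab⟩ := h (s.image fun x => x.2.1) n
    refine ⟨Sum.elim (fun y => a y.1 y.2.1 y.2.2) b, fun x hx => ?_⟩
    refine (realize_ictCondition _ _ _).2 (hab x.1 ?_ _ (Finset.mem_image_of_mem _ hx) _ (hn x hx).1)
    intro i hi
    obtain ⟨y, hy, rfl⟩ := Finset.mem_image.1 hi
    exact (hn x hx).2 y hy)
  exact ⟨⟨P, k, φ, fun i j l => v (.inl ⟨i, j, l⟩), fun η => v (.inr η),
    fun η i j => (realize_ictCondition _ _ _).1 (hv (η, i, j))⟩⟩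

end FinitePatterns
section FinitePatterns

variable {L : Language.{u, v}} {M : Type w} [L.Structure M]

/-- Entries of a path outside `I` may be reset to 0, so it suffices to treat paths bounded in every
row. -/
theorem HasFinitePatterns.of_bounded {ι : Type c} {k : ι → ℕ}
    {φ : ∀ i, L.Formula (Unit ⊕ Fin (k i))} {I : Finset ι} {n : ℕ}
    (a : ∀ i, ℕ → Fin (k i) → M) (b : (ι → ℕ) → M)
    (h : ∀ η : ι → ℕ, (∀ i, η i < n) → ∀ i ∈ I, ∀ j < n,
      (φ i).Realize (Sum.elim (fun _ => b η) (a i j)) ↔ j = η i) :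
    HasFinitePatterns M φ I n := by
  classical
  refine ⟨a, fun η => b fun i => if i ∈ I then η i else 0, fun η hη i hi j hj => ?_⟩
  rw [h _ (fun i => ?_) i hi j hj, if_pos hi]
  split_ifs with hi
  exacts [hη i hi, (Nat.zero_le _).trans_lt hj]

theorem HasFinitePatterns.mono {ι : Type c} {k : ι → ℕ} {φ : ∀ i, L.Formula (Unit ⊕ Fin (k i))}
    {I I' : Finset ι} {n n' : ℕ} (h : HasFinitePatterns M φ I' n') (hI : I ⊆ I') (hn : n ≤ n') :
    HasFinitePatterns M φ I n := by
  obtain ⟨a, b, h⟩ := h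
  exact .of_bounded a b fun η hη i hi j hj =>
    h η (fun i _ => (hη i).trans_le hn) i (hI hi) j (hj.trans_le hn)

theorem HasFinitePatterns.comap {ι ι' : Type c} {k : ι → ℕ}
    {φ : ∀ i, L.Formula (Unit ⊕ Fin (k i))} (f : ι' ↪ ι) {I : Finset ι'} {n : ℕ}
    (h : HasFinitePatterns M φ (I.map f) n) :
    HasFinitePatterns M (fun i => φ (f i)) I n := by
  obtain ⟨a, b, h⟩ := h
  refine ⟨fun i => a (f i), fun η => b (Function.extend f η 0), fun η hη i hi j hj => ?_⟩
  rw [h _ (fun i hi => ?_) (f i) (Finset.mem_map_of_mem f hi) j hj, f.injective.extend_apply]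
  obtain ⟨i', hi', rfl⟩ := Finset.mem_map.1 hi
  rw [f.injective.extend_apply]
  exact hη i' hi'

/-- The formula in `x` and two tuples `y`, `z` saying that `F l (x, y)` and `F l (x, z)` have
different truth values for some `l`. -/
noncomputable def discernFormula {J : Type} [Finite J] {m : ℕ} (F : J → L.Formula (Unit ⊕ Fin m)) :
    L.Formula (Unit ⊕ Fin (m + m)) :=
  Formula.iSup fun l => (((F l).relabel (Sum.map id (Fin.castAdd m))).iff
    ((F l).relabel (Sum.map id (Fin.natAdd m)))).not

theorem realize_discernFormula {J : Type} [Finite J] {m : ℕ} (F : J → L.Formula (Unit ⊕ Fin m))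
    (x : M) (y z : Fin m → M) :
    (discernFormula F).Realize (Sum.elim (fun _ => x) (Fin.append y z)) ↔
      ∃ l, ¬((F l).Realize (Sum.elim (fun _ => x) y) ↔ (F l).Realize (Sum.elim (fun _ => x) z)) := by
  have h₁ : Sum.elim (fun _ => x) (Fin.append y z) ∘ Sum.map id (Fin.castAdd m) =
      (Sum.elim (fun _ => x) y : Unit ⊕ Fin m → M) := by
    funext t; cases t <;> simp
  have h₂ : Sum.elim (fun _ => x) (Fin.append y z) ∘ Sum.map id (Fin.natAdd m) =
      (Sum.elim (fun _ => x) z : Unit ⊕ Fin m → M) := by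
    rw [Sum.elim_comp_map]
    exact congrArg _ (funext fun t => Fin.append_right y z t)
  simp only [discernFormula, Formula.realize_iSup, Formula.realize_not, Formula.realize_iff,
    Formula.realize_relabel, h₁, h₂]

end FinitePatterns

/-! ### Splitting a pattern of the product. -/

section Product

variable {L₀ : Language.{u₀, v₀}} {L₁ : Language.{u₁, v₁}} {M₀ : Type w₀} {M₁ : Type w₁}
  [L₀.Structure M₀] [L₁.Structure M₁]

/-- A finite piece of an ict-pattern in the simple product splits into finite pieces of
ict-patterns in the two factors. -/
theorem exists_hasFinitePatterns_filter {ι : Type c} {k : ι → ℕ}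
    {φ : ∀ i, (simpleProduct L₀ L₁).Formula (Unit ⊕ Fin (k i))} {J₀ J₁ : ι → Type}
    [∀ i, Finite (J₀ i)] [∀ i, Finite (J₁ i)] (F₀ : ∀ i, J₀ i → L₀.Formula (Unit ⊕ Fin (k i)))
    (F₁ : ∀ i, J₁ i → L₁.Formula (Unit ⊕ Fin (k i)))
    (hF : ∀ i (v v' : Unit ⊕ Fin (k i) → M₀ × M₁),
      (∀ l, (F₀ i l).Realize (Prod.fst ∘ v) ↔ (F₀ i l).Realize (Prod.fst ∘ v')) →
      (∀ l, (F₁ i l).Realize (Prod.snd ∘ v) ↔ (F₁ i l).Realize (Prod.snd ∘ v')) →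
      ((φ i).Realize v ↔ (φ i).Realize v'))
    (I : Finset ι) (hφ : ∀ n, HasFinitePatterns (M₀ × M₁) φ I n) (n : ℕ) :
    ∃ s : ι → Bool,
      HasFinitePatterns M₀ (fun i => discernFormula (F₀ i)) (I.filter fun i => s i = true) n ∧
      HasFinitePatterns M₁ (fun i => discernFormula (F₁ i)) (I.filter fun i => s i = false) n := by
  classical
  choose a b hab using hφ
  let tr₀ : ∀ (N : ℕ) (η : ι → ℕ) (i : ι) (j : ℕ), J₀ i → Prop := fun N η i j l =>
    (F₀ i l).Realize (Sum.elim (fun _ => (b N η).1) (Prod.fst ∘ a N i j))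
  let tr₁ : ∀ (N : ℕ) (η : ι → ℕ) (i : ι) (j : ℕ), J₁ i → Prop := fun N η i j l =>
    (F₁ i l).Realize (Sum.elim (fun _ => (b N η).2) (Prod.snd ∘ a N i j))
  -- The index sets vary with the row; their disjoint union gives one finite palette, and colours in
  -- row `i` live on the fibre over `i`.
  let c : ℕ → (ι → ℕ) → ι → ℕ → Set (Σ i : I, J₀ i ⊕ J₁ i) := fun N η i j =>
    {x | (x.1 : ι) = i ∧ Sum.elim (tr₀ N η x.1 j) (tr₁ N η x.1 j) x.2}
  have mem₀ : ∀ N η i (hi : i ∈ I) j l, ⟨⟨i, hi⟩, .inl l⟩ ∈ c N η i j ↔ tr₀ N η i j l :=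
    fun N η i hi j l => by simp [c]
  have mem₁ : ∀ N η i (hi : i ∈ I) j l, ⟨⟨i, hi⟩, .inr l⟩ ∈ c N η i j ↔ tr₁ N η i j l :=
    fun N η i hi j l => by simp [c]
  obtain ⟨N, p, q, d, g, h⟩ := exists_pairs_of_finite_arrays I c (by
    intro N η i j hi hη hj hne heq
    have h := hF i (Sum.elim (fun _ => b N η) (a N i j)) (Sum.elim (fun _ => b N η) (a N i (η i)))
      (fun l => by
        rw [Sum.comp_elim, Sum.comp_elim]
        exact ((mem₀ N η i hi j l).symm.trans (by rw [heq])).trans (mem₀ N η i hi (η i) l))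
      (fun l => by
        rw [Sum.comp_elim, Sum.comp_elim]
        exact ((mem₁ N η i hi j l).symm.trans (by rw [heq])).trans (mem₁ N η i hi (η i) l))
    rw [hab N η hη i hi j hj, hab N η hη i hi _ (hη i hi)] at h
    exact hne (h.2 rfl)) n
  let path : (ι → ℕ) → ι → ℕ := fun η i => q i (η i)
  -- A row goes to coordinate 0 if some formula there separates `d i` from `g i`; otherwise, as `d i
  -- ≠ g i`, a formula in coordinate 1 must.
  refine ⟨fun i => decide (∃ (hi : i ∈ I) (l : J₀ i),
    ¬((⟨⟨i, hi⟩, .inl l⟩ : Σ i : I, J₀ i ⊕ J₁ i) ∈ d i ↔ ⟨⟨i, hi⟩, .inl l⟩ ∈ g i)), ?_, ?_⟩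
  · refine .of_bounded (fun i j => Fin.append (Prod.fst ∘ a N i (p i j)) (Prod.fst ∘ a N i (q i j)))
      (fun η => (b N (path η)).1) fun η hη i hi j hj => ?_
    rw [realize_discernFormula]
    obtain ⟨hiI, hs⟩ := Finset.mem_filter.1 hi
    obtain ⟨_, l, hl⟩ := of_decide_eq_true hs
    have h := h η fun i _ => hη i
    obtain ⟨h₁, h₂⟩ := (h i hiI).2 j hj
    constructor
    · rintro ⟨l', hl'⟩
      by_contra hne
      rw [if_neg hne] at h₁
      refine hl' (((mem₀ N (path η) i hiI _ l').symm.trans ?_).trans (mem₀ N (path η) i hiI _ l'))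
      rw [h₁]
    · intro hjη
      rw [if_pos hjη] at h₁
      refine ⟨l, fun hl' => hl ?_⟩
      rw [← h₁, ← h₂ hjη]
      exact ((mem₀ N (path η) i hiI _ l).trans hl').trans (mem₀ N (path η) i hiI _ l).symm
  · refine .of_bounded (fun i j => Fin.append (Prod.snd ∘ a N i (p i j)) (Prod.snd ∘ a N i (q i j)))
      (fun η => (b N (path η)).2) fun η hη i hi j hj => ?_
    rw [realize_discernFormula]
    obtain ⟨hiI, hs⟩ := Finset.mem_filter.1 hi
    have hs := of_decide_eq_false hs
    have h := h η fun i _ => hη i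
    obtain ⟨h₁, h₂⟩ := (h i hiI).2 j hj
    constructor
    · rintro ⟨l', hl'⟩
      by_contra hne
      rw [if_neg hne] at h₁
      refine hl' (((mem₁ N (path η) i hiI _ l').symm.trans ?_).trans (mem₁ N (path η) i hiI _ l'))
      rw [h₁]
    · intro hjη
      rw [if_pos hjη] at h₁
      by_contra hcon
      push Not at hcon
      refine (h i hiI).1 (Set.ext fun x => ?_)
      by_cases hx : (x.1 : ι) = i
      · obtain ⟨⟨i', hi'⟩, l | l⟩ := x
        · obtain rfl : i' = i := hx
          by_contra hl
          exact hs ⟨hi', l, hl⟩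
        · obtain rfl : i' = i := hx
          rw [← h₁, ← h₂ hjη]
          exact ((mem₁ N (path η) _ hi' _ l).trans (hcon l)).trans (mem₁ N (path η) _ hi' _ l).symm
      · rw [← h₁, ← h₂ hjη]
        exact ⟨fun h => (hx h.1).elim, fun h => (hx h.1).elim⟩

/-- An ict-pattern in the simple product splits into ict-patterns in the two factors. -/
theorem IctPattern.exists_split [Nonempty M₀] [Nonempty M₁] {ι : Type c}
    (p : IctPattern ((simpleProduct L₀ L₁).completeTheory (M₀ × M₁)) ι) :
    ∃ S : Set ι, (∀ (ι' : Type c) (f : ι' ↪ ι), (∀ i, f i ∈ S) →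
        Nonempty (IctPattern (L₀.completeTheory M₀) ι')) ∧
      ∀ (ι' : Type c) (f : ι' ↪ ι), (∀ i, f i ∉ S) →
        Nonempty (IctPattern (L₁.completeTheory M₁) ι') := by
  classical
  choose J₀ J₁ hJ₀ hJ₁ F₀ F₁ hF using fun i => exists_determining_formulas M₀ M₁ (p.φ i)
  have hF' : ∀ i (v v' : Unit ⊕ Fin (p.arity i) → M₀ × M₁),
      (∀ l, Formula.Realize (F₀ i l) (Prod.fst ∘ v) ↔ Formula.Realize (F₀ i l) (Prod.fst ∘ v')) →
      (∀ l, Formula.Realize (F₁ i l) (Prod.snd ∘ v) ↔ Formula.Realize (F₁ i l) (Prod.snd ∘ v')) →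
      ((p.φ i).Realize v ↔ (p.φ i).Realize v') := by
    intro i v v' h₀ h₁
    refine hF i v v' default default (fun l => ?_) fun l => ?_
    · have := h₀ l
      simpa only [Formula.Realize, Subsingleton.elim (Prod.fst ∘ default) default] using this
    · have := h₁ l
      simpa only [Formula.Realize, Subsingleton.elim (Prod.snd ∘ default) default] using this
  choose s hs₀ hs₁ using fun I => exists_hasFinitePatterns_filter F₀ F₁ hF' I
    (p.hasFinitePatterns I)
  -- The assignment of rows to coordinates depends on the finite piece; its limit `S` agrees, on any
  -- finite set of rows, with the assignment of some larger piece.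
  let U : Ultrafilter (Finset ι × ℕ) := Ultrafilter.of atTop
  choose S hS using fun i => U.exists_eventually_eq fun x => s x.1 x.2 i
  have key : ∀ I n, ∃ x : Finset ι × ℕ, (I, n) ≤ x ∧ ∀ i ∈ I, s x.1 x.2 i = S i := fun I n =>
    (((eventually_ge_atTop (I, n)).filter_mono (Ultrafilter.of_le atTop)).and
      ((Finset.eventually_all I).2 fun i _ => hS i)).exists
  refine ⟨{i | S i = true}, fun ι' f hf => ?_, fun ι' f hf => ?_⟩
  · refine nonempty_ictPattern (fun i => discernFormula (F₀ (f i))) fun I n => ?_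
    obtain ⟨x, hx, hxS⟩ := key (I.map f) n
    refine HasFinitePatterns.comap (φ := fun i => discernFormula (F₀ i)) f
      ((hs₀ x.1 x.2).mono (fun i hi => ?_) hx.2)
    refine Finset.mem_filter.2 ⟨hx.1 hi, (hxS i hi).trans ?_⟩
    obtain ⟨i, -, rfl⟩ := Finset.mem_map.1 hi
    exact hf i
  · refine nonempty_ictPattern (fun i => discernFormula (F₁ (f i))) fun I n => ?_
    obtain ⟨x, hx, hxS⟩ := key (I.map f) n
    refine HasFinitePatterns.comap (φ := fun i => discernFormula (F₁ i)) f
      ((hs₁ x.1 x.2).mono (fun i hi => ?_) hx.2)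
    refine Finset.mem_filter.2 ⟨hx.1 hi, (hxS i hi).trans ?_⟩
    obtain ⟨i, -, rfl⟩ := Finset.mem_map.1 hi
    exact Bool.eq_false_iff.2 (hf i)

end Product

/-- Were `S` larger than `κ`, a subset of size exactly `κ⁺` would index a forbidden pattern. -/
theorem StructureDpRankLE.mk_set_le {L : Language.{u, v}} {M : Type w} [L.Structure M]
    {κ : Cardinal.{c}} (h : L.StructureDpRankLE M κ) {ι : Type c} (S : Set ι)
    (hS : ∀ (ι' : Type c) (f : ι' ↪ ι), (∀ i, f i ∈ S) →
      Nonempty (IctPattern (L.completeTheory M) ι')) : Cardinal.mk S ≤ κ := by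
  by_contra! hlt
  obtain ⟨S', hS', hcard⟩ := Cardinal.le_mk_iff_exists_subset.1 (Order.succ_le_of_lt hlt)
  obtain ⟨p⟩ := hS S' (Function.Embedding.subtype _) fun i => hS' i.2
  exact (h S' hcard).false p

end FirstOrder.Language

theorem mainTheorem10
    (L₀ : FirstOrder.Language.{u₀, v₀}) (L₁ : FirstOrder.Language.{u₁, v₁})
    (hfun₀ : ∀ n : ℕ, IsEmpty (L₀.Functions (n + 1)))
    (hfun₁ : ∀ n : ℕ, IsEmpty (L₁.Functions (n + 1)))
    (hconst₀ : Nonempty L₀.Constants) (hconst₁ : Nonempty L₁.Constants)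
    (M₀ : Type w₀) (M₁ : Type w₁) [L₀.Structure M₀] [L₁.Structure M₁]
    (κ₀ κ₁ : Cardinal.{c})
    (h₀ : L₀.StructureDpRankLE M₀ κ₀) (h₁ : L₁.StructureDpRankLE M₁ κ₁) :
    (FirstOrder.Language.simpleProduct L₀ L₁).StructureDpRankLE (M₀ × M₁) (κ₀ + κ₁) := by
  have : Nonempty M₀ := hconst₀.elim fun c => ⟨(c : M₀)⟩
  have : Nonempty M₁ := hconst₁.elim fun c => ⟨(c : M₁)⟩
  refine fun ι hι => ⟨fun p => ?_⟩
  obtain ⟨S, hS₀, hS₁⟩ := p.exists_split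
  have hle : Cardinal.mk ι ≤ κ₀ + κ₁ := by
    rw [← Cardinal.mk_sum_compl S]
    exact add_le_add (h₀.mk_set_le S hS₀) (h₁.mk_set_le Sᶜ hS₁)
  rw [hι] at hle
  exact (Order.lt_succ (κ₀ + κ₁)).not_ge hle
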